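/- Let $P$ be a simple polygon in the plane with vertices $v_0,\dots,v_{n-1}$, $n\ge 3$. We regard $P$ as a closed region, that is, as its boundary $\partial P$ together with the bounded part of the complement of $\partial P$. A point $g\in P$ sees a point $x\in P$ if the closed line segment $\overline{gx}$ is contained in $P$. For $a,b\in\partial P$ let $[a,b]\subseteq\partial P$ be the polygonal chain from $a$ to $b$, both endpoints included, that is obtained by traversing $\partial P$ in the order of the vertices (so $[a,a]=\{a\}$), and let $$F([a,b])=\{g\in P : g \text{ sees every } x\in[a,b]\}$$ be its feasible region. Then for all $a,b\in\partial P$ the set $F([a,b])$ is connected (the empty set counts as connected). Furthermore, for every convex subset $C\subseteq P$, the set $C\cap F([a,b])$ is convex. -/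

import Mathlib

namespace Polygon

/-- A closed polygonal line in the plane is simple if it has at least three vertices, consecutive
vertices are distinct, consecutive edges meet only in their common vertex, and edges that are not
consecutive are disjoint. (A vertex with a straight angle is allowed.) -/
structure IsSimple {n : ℕ} (P : Polygon (EuclideanSpace ℝ (Fin 2)) n) : Prop where
  three_le : 3 ≤ n
  nondegenerate : P.HasNondegenerateEdges
  consecutive : ∀ i : Fin n,
    P.edgeSet ℝ i ∩ P.edgeSet ℝ (finRotate n i) = {P (finRotate n i)}
  nonconsecutive : ∀ i j : Fin n, i ≠ j → j ≠ finRotate n i → i ≠ finRotate n j →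
    Disjoint (P.edgeSet ℝ i) (P.edgeSet ℝ j)

/-- The closed region bounded by the polygon: the boundary together with the points whose
connected component in the complement of the boundary is bounded. -/
def region {n : ℕ} (P : Polygon (EuclideanSpace ℝ (Fin 2)) n) : Set (EuclideanSpace ℝ (Fin 2)) :=
  P.boundary ℝ ∪
    {x | x ∉ P.boundary ℝ ∧ Bornology.IsBounded (connectedComponentIn (P.boundary ℝ)ᶜ x)}

/-- The point `x` sees the point `y` within the polygon: the closed segment from `x` to `y` is
contained in the region of the polygon. -/
def Sees {n : ℕ} (P : Polygon (EuclideanSpace ℝ (Fin 2)) n)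
    (x y : EuclideanSpace ℝ (Fin 2)) : Prop :=
  segment ℝ x y ⊆ P.region

/-- The boundary, traversed in the order of the vertices: the parameter `k + r` with `k` a natural
number and `0 ≤ r < 1` is sent to the point dividing the edge from vertex `k` to vertex `k + 1`
(indices modulo `n`) in the ratio `r : 1 - r`. Used for parameters `s ≥ 0` only. -/
noncomputable def traversal {n : ℕ} [NeZero n] (P : Polygon (EuclideanSpace ℝ (Fin 2)) n)
    (s : ℝ) : EuclideanSpace ℝ (Fin 2) :=
  P.edgePath ℝ (Fin.ofNat n ⌊s⌋₊) (Int.fract s)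

/-- The chain `[a, b]`: the points met when the boundary is traversed from `a` to `b`, for less
than one full turn, in the order of the vertices, endpoints included. -/
def chain {n : ℕ} [NeZero n] (P : Polygon (EuclideanSpace ℝ (Fin 2)) n)
    (a b : EuclideanSpace ℝ (Fin 2)) : Set (EuclideanSpace ℝ (Fin 2)) :=
  {x | ∃ s u t : ℝ, 0 ≤ s ∧ s ≤ u ∧ u ≤ t ∧ t < s + n ∧
    P.traversal s = a ∧ P.traversal u = x ∧ P.traversal t = b}

/-- The feasible region of the chain `[a, b]`: all points of the polygon that see every point of
the chain. -/
def feasibleRegion {n : ℕ} [NeZero n] (P : Polygon (EuclideanSpace ℝ (Fin 2)) n)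
    (a b : EuclideanSpace ℝ (Fin 2)) : Set (EuclideanSpace ℝ (Fin 2)) :=
  {g | g ∈ P.region ∧ ∀ x ∈ P.chain a b, P.Sees g x}

end Polygon

/-!
The proof uses only two properties of the region `R` of a polygon: it is compact, and it has no
holes, in the sense that a bounded set whose frontier lies in `R` is contained in `R`
(`HoleFree`). The second holds because every component of `Rᶜ` is unbounded, hence leaves every
bounded set that it meets through the frontier of that set. The feasible region of a chain is the
set of points seeing a given nonempty set `S`, and it turns out that the shape of `S` is irrelevant:
for every nonempty `S` the set `commonlyVisible R S` has the two asserted properties.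

Convexity: if `a` and `b` see each other and both see `x`, then the sides of the triangle `a b x`
lie in `R`, so the whole triangle does, and each point of the segment `a b` sees `x`
(`HoleFree.segment_subset`).

Connectedness: suppose the compact set `commonlyVisible R S` is the union of two disjoint nonempty
closed sets `A` and `B`. Fix `c ∈ S` and choose `a ∈ A` and `b ∈ B` such that the area of the
triangle `a b c` is minimal. If the segment `a b` lies in `R`, it is a connected subset of
`commonlyVisible R S` that meets both sets, which is impossible. Otherwise, all points of `S` lie
strictly on the same side of the line `a b` (`HoleFree.segment_subset_of_opposite`), and all the
triangles `a b x` with `x ∈ S` have the same part outside `R` (`HoleFree.triangle_diff_subset`). Let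
`q` be a point of the closure of this part that is farthest from the line `a b`. On the way from `q`
to a point `x` of `S` the distance from this line grows, and a point of this way outside `R` would
be followed by others that are farther from the line than `q`. So `q` sees all of `S`. As `q`
belongs to the triangle `a b c` and is not on the line `a b`, the triangles `a q c` and `q b c` are
smaller than `a b c`, and one of them contradicts the choice of `a` and `b`
(`HoleFree.exists_mem_commonlyVisible`).
-/

namespace Polygon

open Set Topology Bornology

section

variable {a b c c' p : EuclideanSpace ℝ (Fin 2)} {R S : Set (EuclideanSpace ℝ (Fin 2))}

/-! ### Signed area and triangles -/

/-- Twice the signed area of the triangle `a b c`; positive when the triangle is oriented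
counterclockwise. -/
noncomputable def area (a b c : EuclideanSpace ℝ (Fin 2)) : ℝ :=
  (b 0 - a 0) * (c 1 - a 1) - (b 1 - a 1) * (c 0 - a 0)

/-- The closed triangle `a b c` as an intersection of three half-planes. This is the intended set
only if the triangle is oriented counterclockwise, that is, if `0 < area a b c`. -/
def triangle (a b c : EuclideanSpace ℝ (Fin 2)) : Set (EuclideanSpace ℝ (Fin 2)) :=
  {p | 0 ≤ area a b p ∧ 0 ≤ area b c p ∧ 0 ≤ area c a p}

theorem area_rotate (a b c : EuclideanSpace ℝ (Fin 2)) : area b c a = area a b c := by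
  simp only [area]; ring

theorem area_swap (a b c : EuclideanSpace ℝ (Fin 2)) : area b a c = -area a b c := by
  simp only [area]; ring

theorem area_add_area_add_area (a b c p : EuclideanSpace ℝ (Fin 2)) :
    area a b p + area b c p + area c a p = area a b c := by
  simp only [area]; ring

theorem area_combo (a b p q : EuclideanSpace ℝ (Fin 2)) (t : ℝ) :
    area a b ((1 - t) • p + t • q) = (1 - t) * area a b p + t * area a b q := by
  simp [area]; ring

@[simp]
theorem area_self_left (a b : EuclideanSpace ℝ (Fin 2)) : area a b a = 0 := by
  simp [area]

@[simp]
theorem area_self_right (a b : EuclideanSpace ℝ (Fin 2)) : area a b b = 0 := by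
  simp only [area]; ring

theorem continuous_area (a b : EuclideanSpace ℝ (Fin 2)) : Continuous fun p => area a b p := by
  unfold area
  fun_prop

/-- Barycentric coordinates, cleared of the denominator. -/
theorem area_smul_eq (a b c p : EuclideanSpace ℝ (Fin 2)) :
    area a b c • p = area b c p • a + area c a p • b + area a b p • c := by
  ext i
  fin_cases i <;> simp [area] <;> ring

theorem triangle_rotate (a b c : EuclideanSpace ℝ (Fin 2)) : triangle b c a = triangle a b c := by
  ext p
  simp only [triangle, mem_ofPred_eq]
  tauto

theorem isClosed_triangle (a b c : EuclideanSpace ℝ (Fin 2)) : IsClosed (triangle a b c) :=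
  (isClosed_le continuous_const (continuous_area a b)).inter
    ((isClosed_le continuous_const (continuous_area b c)).inter
      (isClosed_le continuous_const (continuous_area c a)))

theorem combo_mem_triangle {q : EuclideanSpace ℝ (Fin 2)} (hp : p ∈ triangle a b c)
    (hq : q ∈ triangle a b c) {t : ℝ} (ht : t ∈ Icc (0 : ℝ) 1) :
    (1 - t) • p + t • q ∈ triangle a b c := by
  obtain ⟨h0, h1⟩ := ht
  have h1' : 0 ≤ 1 - t := by linarith
  obtain ⟨hp1, hp2, hp3⟩ := hp
  obtain ⟨hq1, hq2, hq3⟩ := hq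
  refine ⟨?_, ?_, ?_⟩ <;> rw [area_combo] <;> positivity

theorem apex_mem_triangle (h : 0 ≤ area a b c) : c ∈ triangle a b c :=
  ⟨h, by simp, by simp⟩

theorem base_subset_triangle (h : 0 ≤ area a b c) : segment ℝ a b ⊆ triangle a b c := by
  rw [segment_eq_image]
  rintro _ ⟨t, ht, rfl⟩
  refine combo_mem_triangle ⟨by simp, ?_, by simp⟩ ⟨by simp, by simp, ?_⟩ ht
  · rwa [area_rotate]
  · rwa [← area_rotate]

theorem mem_segment_of_area_eq_zero (h : 0 < area a b c) (hp : p ∈ triangle a b c)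
    (h0 : area a b p = 0) : p ∈ segment ℝ a b := by
  obtain ⟨-, h2, h3⟩ := hp
  have hs := area_add_area_add_area a b c p
  refine ⟨area b c p / area a b c, area c a p / area a b c, by positivity, by positivity, ?_, ?_⟩
  · field_simp
    linarith
  · have := area_smul_eq a b c p
    rw [h0, zero_smul, add_zero] at this
    rw [div_eq_inv_mul, div_eq_inv_mul, mul_smul, mul_smul, ← smul_add, ← this, smul_smul,
      inv_mul_cancel₀ h.ne', one_smul]

theorem isBounded_triangle (h : 0 < area a b c) : IsBounded (triangle a b c) := by
  refine (Metric.isBounded_closedBall (x := 0) (r := ‖a‖ + ‖b‖ + ‖c‖)).subset ?_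
  intro p hp
  obtain ⟨h1, h2, h3⟩ := hp
  have hs := area_add_area_add_area a b c p
  rw [mem_closedBall_zero_iff]
  refine le_of_mul_le_mul_left ?_ h
  calc area a b c * ‖p‖ = ‖area b c p • a + area c a p • b + area a b p • c‖ := by
        rw [← area_smul_eq, norm_smul, Real.norm_of_nonneg h.le]
    _ ≤ area b c p * ‖a‖ + area c a p * ‖b‖ + area a b p * ‖c‖ := by
        refine (norm_add₃_le).trans_eq ?_
        simp only [norm_smul, Real.norm_of_nonneg h1, Real.norm_of_nonneg h2,
          Real.norm_of_nonneg h3]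
    _ ≤ area a b c * ‖a‖ + area a b c * ‖b‖ + area a b c * ‖c‖ := by
        gcongr <;> linarith
    _ = area a b c * (‖a‖ + ‖b‖ + ‖c‖) := by ring

theorem frontier_triangle_subset (h : 0 < area a b c) :
    frontier (triangle a b c) ⊆ segment ℝ a b ∪ segment ℝ b c ∪ segment ℝ c a := by
  intro p hp
  have hT : p ∈ triangle a b c := (isClosed_triangle a b c).frontier_subset hp
  by_cases h1 : area a b p = 0
  · exact Or.inl (Or.inl (mem_segment_of_area_eq_zero h hT h1))
  by_cases h2 : area b c p = 0
  · refine Or.inl (Or.inr (mem_segment_of_area_eq_zero (c := a) ?_ ?_ h2))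
    · rwa [area_rotate]
    · rwa [triangle_rotate]
  by_cases h3 : area c a p = 0
  · refine Or.inr (mem_segment_of_area_eq_zero (c := b) ?_ ?_ h3)
    · rwa [← area_rotate]
    · rwa [← triangle_rotate]
  refine absurd ?_ hp.2
  refine mem_interior.2 ⟨{p | 0 < area a b p ∧ 0 < area b c p ∧ 0 < area c a p},
    fun q hq => ⟨hq.1.le, hq.2.1.le, hq.2.2.le⟩, ?_,
    lt_of_le_of_ne hT.1 (Ne.symm h1), lt_of_le_of_ne hT.2.1 (Ne.symm h2),
    lt_of_le_of_ne hT.2.2 (Ne.symm h3)⟩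
  exact (isOpen_lt continuous_const (continuous_area a b)).inter
    ((isOpen_lt continuous_const (continuous_area b c)).inter
      (isOpen_lt continuous_const (continuous_area c a)))

theorem area_pos_of_mem_base (h : 0 < area a b c) (hp : p ∈ segment ℝ a b) (ha : p ≠ a)
    (hb : p ≠ b) : 0 < area b c p ∧ 0 < area c a p := by
  rw [segment_eq_image] at hp
  obtain ⟨t, ⟨h0, h1⟩, rfl⟩ := hp
  have h0' : 0 < t := lt_of_le_of_ne h0 (by rintro rfl; simp at ha)
  have h1' : 0 < 1 - t := sub_pos.2 (lt_of_le_of_ne h1 (by rintro rfl; simp at hb))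
  simp only [area_combo, area_self_left, area_self_right, area_rotate a b c,
    ← area_rotate c a b, mul_zero, add_zero, zero_add]
  exact ⟨mul_pos h1' h, mul_pos h0' h⟩

/-- A segment is covered by the segments from its endpoints to a point collinear with them. -/
theorem segment_subset_of_area_eq_zero (h : area a b c = 0) :
    segment ℝ a b ⊆ segment ℝ a c ∪ segment ℝ b c := by
  rcases eq_or_ne a b with rfl | hab
  · simp [left_mem_segment]
  obtain ⟨s, hs⟩ : ∃ s : ℝ, c = (1 - s) • a + s • b := by
    have hd : (b 0 - a 0) ^ 2 + (b 1 - a 1) ^ 2 ≠ 0 := by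
      intro h0
      apply hab
      ext i
      fin_cases i
      · simp only [Fin.zero_eta]; nlinarith [sq_nonneg (b 0 - a 0), sq_nonneg (b 1 - a 1)]
      · simp only [Fin.mk_one]; nlinarith [sq_nonneg (b 0 - a 0), sq_nonneg (b 1 - a 1)]
    refine ⟨((b 0 - a 0) * (c 0 - a 0) + (b 1 - a 1) * (c 1 - a 1)) /
      ((b 0 - a 0) ^ 2 + (b 1 - a 1) ^ 2), ?_⟩
    unfold area at h
    ext i
    fin_cases i
    · simp
      field_simp
      linear_combination (b 1 - a 1) * (-h)
    · simp
      field_simp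
      linear_combination (b 0 - a 0) * h
  subst hs
  simp only [segment_eq_image]
  rintro _ ⟨t, ⟨h0, h1⟩, rfl⟩
  rcases le_or_gt t s with hts | hts
  · left
    rcases h0.eq_or_lt with rfl | h0
    · exact ⟨0, by simp, by simp⟩
    have hs : 0 < s := by linarith
    refine ⟨t / s, ⟨by positivity, (div_le_one hs).2 hts⟩, ?_⟩
    ext i
    simp
    field_simp
    ring
  · right
    have hs : 0 < 1 - s := by linarith
    refine ⟨(1 - t) / (1 - s), ⟨div_nonneg (by linarith) hs.le,
      (div_le_one hs).2 (by linarith)⟩, ?_⟩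
    ext i
    simp
    field_simp
    ring

/-! ### Sets without holes -/

/-- A set has no holes if it contains every bounded set whose frontier it contains. -/
def HoleFree (R : Set (EuclideanSpace ℝ (Fin 2))) : Prop :=
  ∀ Q : Set (EuclideanSpace ℝ (Fin 2)), IsBounded Q → frontier Q ⊆ R → Q ⊆ R

theorem HoleFree.triangle_subset (hR : HoleFree R) (h : 0 < area a b c)
    (hab : segment ℝ a b ⊆ R) (hac : segment ℝ a c ⊆ R) (hbc : segment ℝ b c ⊆ R) :
    triangle a b c ⊆ R :=
  hR _ (isBounded_triangle h) ((frontier_triangle_subset h).trans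
    (union_subset (union_subset hab hbc) (by rwa [segment_symm])))

/-- A point of the plane that sees both ends of a segment in a set without holes is seen from every
point of this segment. -/
theorem HoleFree.segment_subset (hR : HoleFree R) (hab : segment ℝ a b ⊆ R)
    (hac : segment ℝ a c ⊆ R) (hbc : segment ℝ b c ⊆ R) (hp : p ∈ segment ℝ a b) :
    segment ℝ p c ⊆ R := by
  have main : ∀ {a b : EuclideanSpace ℝ (Fin 2)}, segment ℝ a b ⊆ R → segment ℝ a c ⊆ R →
      segment ℝ b c ⊆ R → p ∈ segment ℝ a b → 0 < area a b c → segment ℝ p c ⊆ R := by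
    intro a b hab hac hbc hp h
    refine subset_trans ?_ (hR.triangle_subset h hab hac hbc)
    rw [segment_eq_image]
    rintro _ ⟨t, ht, rfl⟩
    exact combo_mem_triangle (base_subset_triangle h.le hp) (apex_mem_triangle h.le) ht
  rcases lt_trichotomy (area a b c) 0 with h | h | h
  · refine main (by rwa [segment_symm]) hbc hac (by rwa [segment_symm]) ?_
    rw [area_swap]
    linarith
  · have hpa : area p c a = 0 := by
      rw [segment_eq_image] at hp
      obtain ⟨t, -, rfl⟩ := hp
      change area ((1 - t) • a + t • b) c a = 0
      rw [← area_rotate _ c a, area_combo, area_self_right, area_rotate b c a, area_rotate, h]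
      simp
    refine (segment_subset_of_area_eq_zero hpa).trans (union_subset ?_ ?_)
    · exact ((convex_segment a b).segment_subset hp (left_mem_segment ℝ a b)).trans hab
    · rwa [segment_symm]
  · exact main hab hac hbc hp h

/-- In a set without holes, the points `a` and `b` see each other as soon as both of them see two
points that lie on different sides of the line `a b`. -/
theorem HoleFree.segment_subset_of_opposite (hR : HoleFree R) (hc : 0 < area a b c)
    (hc' : area a b c' < 0) (hac : segment ℝ a c ⊆ R) (hbc : segment ℝ b c ⊆ R)
    (hac' : segment ℝ a c' ⊆ R) (hbc' : segment ℝ b c' ⊆ R) : segment ℝ a b ⊆ R := by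
  have hc2 : 0 < area b a c' := by rw [area_swap]; linarith
  suffices h : triangle a b c ∪ triangle b a c' ⊆ R from
    (base_subset_triangle hc.le).trans (subset_union_left.trans h)
  refine hR _ ((isBounded_triangle hc).union (isBounded_triangle hc2)) ?_
  intro p hp
  by_contra hpR
  have hpa : p ≠ a := by rintro rfl; exact hpR (hac (left_mem_segment ℝ _ _))
  have hpb : p ≠ b := by rintro rfl; exact hpR (hbc (left_mem_segment ℝ _ _))
  have hps : p ∈ segment ℝ a b := by
    rcases frontier_union_subset _ _ hp with h | h
    · rcases frontier_triangle_subset hc h.1 with (h | h) | h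
      · exact h
      · exact absurd (hbc h) hpR
      · exact absurd (hac (by rwa [segment_symm])) hpR
    · rcases frontier_triangle_subset hc2 h.2 with (h | h) | h
      · rwa [segment_symm]
      · exact absurd (hac' h) hpR
      · exact absurd (hbc' (by rwa [segment_symm])) hpR
  obtain ⟨h1, h2⟩ := area_pos_of_mem_base hc hps hpa hpb
  obtain ⟨h3, h4⟩ := area_pos_of_mem_base hc2 (by rwa [segment_symm]) hpb hpa
  -- the two triangles together cover a neighbourhood of each inner point of their common base
  refine hp.2 (mem_interior.2 ⟨{q | (0 < area b c q ∧ 0 < area c a q) ∧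
    (0 < area a c' q ∧ 0 < area c' b q)}, ?_, ?_, ⟨h1, h2⟩, h3, h4⟩)
  · rintro q ⟨⟨h1, h2⟩, h3, h4⟩
    rcases le_total 0 (area a b q) with h | h
    · exact Or.inl ⟨h, h1.le, h2.le⟩
    · exact Or.inr ⟨by rw [area_swap]; linarith, h3.le, h4.le⟩
  · exact ((isOpen_lt continuous_const (continuous_area b c)).inter
      (isOpen_lt continuous_const (continuous_area c a))).inter
      ((isOpen_lt continuous_const (continuous_area a c')).inter
      (isOpen_lt continuous_const (continuous_area c' b)))

/-- If `a` and `b` both see two points `c` and `c'` on the same side of the line `a b`, then the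
part of the triangle `a b c` outside a set without holes lies in the triangle `a b c'`. -/
theorem HoleFree.triangle_diff_subset (hR : HoleFree R) (hc : 0 < area a b c)
    (hc' : 0 < area a b c') (hac : segment ℝ a c ⊆ R) (hbc : segment ℝ b c ⊆ R)
    (hac' : segment ℝ a c' ⊆ R) (hbc' : segment ℝ b c' ⊆ R) :
    triangle a b c \ R ⊆ triangle a b c' := by
  suffices h : triangle a b c \ triangle a b c' ⊆ R by
    rintro p ⟨hp, hpR⟩
    by_contra hp'
    exact hpR (h ⟨hp, hp'⟩)
  refine hR _ ((isBounded_triangle hc).subset sdiff_subset) ?_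
  intro p hp
  by_contra hpR
  have hpa : p ≠ a := by rintro rfl; exact hpR (hac (left_mem_segment ℝ _ _))
  have hpb : p ≠ b := by rintro rfl; exact hpR (hbc (left_mem_segment ℝ _ _))
  have hps : p ∈ segment ℝ a b := by
    rcases frontier_inter_subset _ _ hp with h | h
    · rcases frontier_triangle_subset hc h.1 with (h | h) | h
      · exact h
      · exact absurd (hbc h) hpR
      · exact absurd (hac (by rwa [segment_symm])) hpR
    · have h : p ∈ frontier (triangle a b c')ᶜ := h.2
      rw [frontier_compl] at h
      rcases frontier_triangle_subset hc' h with (h | h) | h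
      · exact h
      · exact absurd (hbc' h) hpR
      · exact absurd (hac' (by rwa [segment_symm])) hpR
  obtain ⟨h3, h4⟩ := area_pos_of_mem_base hc' hps hpa hpb
  -- near an inner point of the common base, the first triangle is contained in the second
  obtain ⟨q, ⟨h3, h4⟩, hq, hq'⟩ := mem_closure_iff.1 hp.1
    {q | 0 < area b c' q ∧ 0 < area c' a q}
    ((isOpen_lt continuous_const (continuous_area b c')).inter
      (isOpen_lt continuous_const (continuous_area c' a))) ⟨h3, h4⟩
  exact hq' ⟨hq.1, h3.le, h4.le⟩

/-! ### Points that see a whole set -/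

/-- The points of `R` that see every point of `S` within `R`. -/
def commonlyVisible (R S : Set (EuclideanSpace ℝ (Fin 2))) : Set (EuclideanSpace ℝ (Fin 2)) :=
  {g | g ∈ R ∧ ∀ x ∈ S, segment ℝ g x ⊆ R}

theorem isClosed_commonlyVisible (hR : IsClosed R) (S : Set (EuclideanSpace ℝ (Fin 2))) :
    IsClosed (commonlyVisible R S) := by
  have : commonlyVisible R S =
      R ∩ ⋂ x ∈ S, ⋂ t ∈ Icc (0 : ℝ) 1, {g | (1 - t) • g + t • x ∈ R} := by
    ext g
    simp only [commonlyVisible, segment_eq_image, image_subset_iff, mem_inter_iff, mem_iInter]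
    rfl
  rw [this]
  refine hR.inter (isClosed_biInter fun x _ => isClosed_biInter fun t _ => ?_)
  exact hR.preimage (by fun_prop : Continuous fun g : EuclideanSpace ℝ (Fin 2) =>
    (1 - t) • g + t • x)

theorem HoleFree.segment_subset_commonlyVisible (hR : HoleFree R)
    (ha : a ∈ commonlyVisible R S) (hb : b ∈ commonlyVisible R S) (hab : segment ℝ a b ⊆ R) :
    segment ℝ a b ⊆ commonlyVisible R S :=
  fun _ hp => ⟨hab hp, fun x hx => hR.segment_subset hab (ha.2 x hx) (hb.2 x hx) hp⟩

/-- Let `a` and `b` see all of `S` but not each other. A point of the closure of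
`triangle a b c \ R` at maximal distance from the line `a b` sees all of `S`, too. -/
theorem HoleFree.exists_mem_commonlyVisible_of_area_pos (hR : HoleFree R) (hRc : IsClosed R)
    (ha : a ∈ commonlyVisible R S) (hb : b ∈ commonlyVisible R S) (hc : c ∈ S)
    (habc : 0 < area a b c) (hab : ¬ segment ℝ a b ⊆ R) :
    ∃ q ∈ commonlyVisible R S, q ∈ triangle a b c ∧ 0 < area a b q := by
  have hpos : ∀ x ∈ S, 0 < area a b x := by
    intro x hx
    rcases lt_trichotomy (area a b x) 0 with h | h | h
    · exact absurd (hR.segment_subset_of_opposite habc h (ha.2 c hc) (hb.2 c hc) (ha.2 x hx)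
        (hb.2 x hx)) hab
    · exact absurd ((segment_subset_of_area_eq_zero h).trans
        (union_subset (ha.2 x hx) (hb.2 x hx))) hab
    · exact h
  obtain ⟨y, hy, hyR⟩ := not_subset.1 hab
  -- a point outside `R` can be moved a little in any direction within `Rᶜ`
  have hmove : ∀ z ∉ R, ∀ x, ∃ t ∈ Ioo (0 : ℝ) 1, (1 - t) • z + t • x ∉ R := by
    intro z hz x
    have hcont : Continuous fun t : ℝ => (1 - t) • z + t • x := by fun_prop
    have h0 : ∀ᶠ t : ℝ in 𝓝 0, (1 - t) • z + t • x ∉ R :=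
      hcont.continuousAt.eventually (hRc.isOpen_compl.mem_nhds (by simpa using hz))
    have h1 : ∀ᶠ t : ℝ in 𝓝[>] 0, t ∈ Ioo (0 : ℝ) 1 := Ioo_mem_nhdsGT one_pos
    obtain ⟨t, ht, ht'⟩ := (h1.and (h0.filter_mono nhdsWithin_le_nhds)).exists
    exact ⟨t, ht, ht'⟩
  have hKT : closure (triangle a b c \ R) ⊆ triangle a b c :=
    closure_minimal sdiff_subset (isClosed_triangle a b c)
  have hcpt : IsCompact (closure (triangle a b c \ R)) :=
    Metric.isCompact_of_isClosed_isBounded isClosed_closure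
      ((isBounded_triangle habc).subset hKT)
  have hyT : y ∈ triangle a b c := base_subset_triangle habc.le hy
  obtain ⟨q, hq, hmax⟩ := hcpt.exists_isMaxOn ⟨y, subset_closure ⟨hyT, hyR⟩⟩
    (continuous_area a b).continuousOn
  have hmax : ∀ z ∈ triangle a b c, z ∉ R → area a b z ≤ area a b q :=
    fun z hz hzR => hmax (subset_closure ⟨hz, hzR⟩)
  have hsees : ∀ x ∈ S, segment ℝ q x ⊆ R := by
    intro x hx z hz
    by_contra hzR
    have hxpos := hpos x hx
    have hsub : closure (triangle a b c \ R) ⊆ triangle a b x :=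
      closure_minimal (hR.triangle_diff_subset habc hxpos (ha.2 c hc) (hb.2 c hc) (ha.2 x hx)
        (hb.2 x hx)) (isClosed_triangle a b x)
    have hsub' := hR.triangle_diff_subset hxpos habc (ha.2 x hx) (hb.2 x hx) (ha.2 c hc)
      (hb.2 c hc)
    have hqx := hsub hq
    have hxx := apex_mem_triangle hxpos.le
    obtain ⟨t, ht, hz'⟩ := hmove z hzR x
    rw [segment_eq_image] at hz
    obtain ⟨s, hs, rfl⟩ := hz
    have hzx := combo_mem_triangle hqx hxx hs
    have hzx' := combo_mem_triangle hzx hxx (Ioo_subset_Icc_self ht)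
    have hle := hmax _ (hsub' ⟨hzx', hz'⟩) hz'
    rw [area_combo, area_combo] at hle
    have hsum := area_add_area_add_area a b x q
    obtain ⟨hq1, hq2, hq3⟩ := hqx
    -- `q` is no farther from the base than `x`, and as far only if the two coincide
    rcases (show area a b q ≤ area a b x by linarith).eq_or_lt with heq | hlt
    · have hqe : q = x := by
        have := area_smul_eq a b x q
        rw [show area b x q = 0 by linarith, show area x a q = 0 by linarith, heq] at this
        simpa [hxpos.ne'] using this
      refine hzR ?_
      change (1 - s) • q + s • x ∈ R
      rw [hqe, ← add_smul, sub_add_cancel, one_smul]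
      exact ha.2 x hx (right_mem_segment ℝ a x)
    · nlinarith [mul_pos ht.1 (sub_pos.2 hlt), mul_nonneg hs.1 (sub_pos.2 hlt).le,
        mul_nonneg (mul_nonneg hs.1 (sub_nonneg.2 ht.2.le)) (sub_pos.2 hlt).le]
  refine ⟨q, ⟨hsees c hc (left_mem_segment ℝ q c), hsees⟩, hKT hq, ?_⟩
  obtain ⟨t, ht, hy'⟩ := hmove y hyR c
  have hle := hmax _ (combo_mem_triangle hyT (apex_mem_triangle habc.le)
    (Ioo_subset_Icc_self ht)) hy'
  rw [area_combo] at hle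
  nlinarith [mul_nonneg (sub_nonneg.2 ht.2.le) hyT.1, mul_pos ht.1 habc]

/-- If `a` and `b` see all of `S` but not each other, then some point `q` that sees all of `S` makes
the triangles `a q c` and `q b c` both smaller than `a b c`. -/
theorem HoleFree.exists_mem_commonlyVisible (hR : HoleFree R) (hRc : IsClosed R)
    (ha : a ∈ commonlyVisible R S) (hb : b ∈ commonlyVisible R S) (hc : c ∈ S)
    (hab : ¬ segment ℝ a b ⊆ R) :
    ∃ q ∈ commonlyVisible R S, |area a q c| < |area a b c| ∧ |area q b c| < |area a b c| := by
  have main : ∀ {a b}, a ∈ commonlyVisible R S → b ∈ commonlyVisible R S →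
      ¬ segment ℝ a b ⊆ R → 0 < area a b c →
      ∃ q ∈ commonlyVisible R S, |area a q c| < |area a b c| ∧ |area q b c| < |area a b c| := by
    intro a b ha hb hab h
    obtain ⟨q, hq, ⟨-, h2, h3⟩, h1⟩ :=
      hR.exists_mem_commonlyVisible_of_area_pos hRc ha hb hc h hab
    have hsum := area_add_area_add_area a b c q
    refine ⟨q, hq, ?_⟩
    rw [area_rotate c a q, ← area_rotate q b c, abs_of_pos h, abs_of_nonneg h2, abs_of_nonneg h3]
    constructor <;> linarith
  rcases lt_trichotomy (area a b c) 0 with h | h | h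
  · obtain ⟨q, hq, h1, h2⟩ := main hb ha (by rwa [segment_symm]) (by rw [area_swap]; linarith)
    refine ⟨q, hq, ?_, ?_⟩
    · rwa [area_swap, area_swap b a, abs_neg, abs_neg]
    · rwa [area_swap, area_swap b a, abs_neg, abs_neg]
  · exact absurd ((segment_subset_of_area_eq_zero h).trans
      (union_subset (ha.2 c hc) (hb.2 c hc))) hab
  · exact main ha hb hab h

/-- Given a partition of the set into two closed parts, a pair of points from either part whose
triangle with a fixed point of `S` has minimal area yields a contradiction. -/
theorem HoleFree.isPreconnected_commonlyVisible (hR : HoleFree R) (hRc : IsCompact R)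
    (hS : S.Nonempty) : IsPreconnected (commonlyVisible R S) := by
  obtain ⟨c, hc⟩ := hS
  have hF : IsCompact (commonlyVisible R S) :=
    hRc.of_isClosed_subset (isClosed_commonlyVisible hRc.isClosed S) fun _ h => h.1
  rw [isPreconnected_closed_iff]
  intro A B hA hB hcover hneA hneB
  by_contra hne
  obtain ⟨⟨a, b⟩, ⟨ha, hb⟩, hmin⟩ := ((hF.inter_right hA).prod (hF.inter_right hB)).exists_isMinOn
    (hneA.prod hneB) (f := fun x => |area x.1 x.2 c|) (by unfold area; fun_prop)
  have hmin : ∀ x ∈ commonlyVisible R S ∩ A, ∀ y ∈ commonlyVisible R S ∩ B,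
      |area a b c| ≤ |area x y c| := fun x hx y hy => hmin (mk_mem_prod hx hy)
  by_cases hab : segment ℝ a b ⊆ R
  · have hsub := hR.segment_subset_commonlyVisible ha.1 hb.1 hab
    obtain ⟨x, hx, hx'⟩ := isPreconnected_closed_iff.1 (convex_segment a b).isPreconnected A B hA hB
      (hsub.trans hcover) ⟨a, left_mem_segment ℝ a b, ha.2⟩ ⟨b, right_mem_segment ℝ a b, hb.2⟩
    exact hne ⟨x, hsub hx, hx'⟩
  · obtain ⟨q, hq, h1, h2⟩ := hR.exists_mem_commonlyVisible hRc.isClosed ha.1 hb.1 hc hab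
    rcases hcover hq with hqA | hqB
    · exact absurd (hmin q ⟨hq, hqA⟩ b hb) h2.not_ge
    · exact absurd (hmin a ha q ⟨hq, hqB⟩) h1.not_ge

theorem HoleFree.convex_inter_commonlyVisible (hR : HoleFree R)
    {C : Set (EuclideanSpace ℝ (Fin 2))} (hCR : C ⊆ R) (hC : Convex ℝ C) :
    Convex ℝ (C ∩ commonlyVisible R S) := by
  rw [convex_iff_segment_subset]
  intro a ha b hb
  have hab := hC.segment_subset ha.1 hb.1
  exact subset_inter hab (hR.segment_subset_commonlyVisible ha.2 hb.2 (hab.trans hCR))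

end

/-! ### The region of a polygon -/

variable {n : ℕ} (P : Polygon (EuclideanSpace ℝ (Fin 2)) n)

theorem isCompact_boundary : IsCompact (P.boundary ℝ) := by
  refine isCompact_iUnion fun i => ?_
  rw [edgeSet_eq_image_edgePath]
  refine isCompact_Icc.image ?_
  unfold edgePath
  exact AffineMap.lineMap_continuous

/-- The complement of the region consists of the unbounded components of the complement of the
boundary. -/
theorem compl_region_eq :
    P.regionᶜ = {x | x ∈ (P.boundary ℝ)ᶜ ∧
      ¬ IsBounded (connectedComponentIn (P.boundary ℝ)ᶜ x)} := by
  ext x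
  simp only [region, mem_compl_iff, mem_union, mem_ofPred_eq]
  tauto

theorem connectedComponentIn_subset_compl_region {x : EuclideanSpace ℝ (Fin 2)}
    (hx : x ∈ P.regionᶜ) : connectedComponentIn (P.boundary ℝ)ᶜ x ⊆ P.regionᶜ := by
  rw [compl_region_eq] at hx ⊢
  intro y hy
  refine ⟨connectedComponentIn_subset _ _ hy, ?_⟩
  rw [← connectedComponentIn_eq hy]
  exact hx.2

/-- The region of a polygon has no holes, as all components of its complement are unbounded. -/
theorem holeFree_region : HoleFree P.region := by
  intro Q hQ hfr x hxQ
  by_contra hx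
  have hU := connectedComponentIn_subset_compl_region P hx
  have hx' : x ∈ P.regionᶜ := hx
  rw [compl_region_eq] at hx'
  refine hx'.2 (hQ.subset ?_)
  -- the component of `x` does not meet the frontier of `Q`, so it stays inside `Q`
  have hcover : connectedComponentIn (P.boundary ℝ)ᶜ x ⊆ interior Q ∪ (closure Q)ᶜ := by
    intro y hy
    by_contra hyQ
    rw [mem_union, not_or, mem_compl_iff, not_not] at hyQ
    exact hU hy (hfr ⟨hyQ.2, hyQ.1⟩)
  have hxU := mem_connectedComponentIn hx'.1
  have hdisj : Disjoint (interior Q) (closure Q)ᶜ :=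
    disjoint_compl_right.mono_left (interior_subset.trans subset_closure)
  have hxint : x ∈ interior Q := (hcover hxU).resolve_right fun h => h (subset_closure hxQ)
  exact (isPreconnected_connectedComponentIn.subset_left_of_subset_union isOpen_interior
    isClosed_closure.isOpen_compl hdisj hcover ⟨x, hxU, hxint⟩).trans interior_subset

theorem isClosed_region : IsClosed P.region := by
  rw [← isOpen_compl_iff, isOpen_iff_mem_nhds]
  intro x hx
  have hx' := hx
  rw [compl_region_eq] at hx'
  exact Filter.mem_of_superset
    (P.isCompact_boundary.isClosed.isOpen_compl.connectedComponentIn.mem_nhds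
      (mem_connectedComponentIn hx'.1)) (connectedComponentIn_subset_compl_region P hx)

theorem isBounded_region : IsBounded P.region := by
  obtain ⟨r, hr, hsub⟩ := P.isCompact_boundary.isBounded.subset_closedBall_lt 0 0
  refine (Metric.isBounded_closedBall (x := 0) (r := r)).subset ?_
  intro x hx
  by_contra hxr
  rw [mem_closedBall_zero_iff, not_le] at hxr
  -- the ray from `x` away from the origin does not meet the boundary
  have hray : (fun t : ℝ => t • x) '' Ici 1 ⊆ (P.boundary ℝ)ᶜ := by
    rintro _ ⟨t, ht, rfl⟩ hb
    have := hsub hb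
    rw [mem_closedBall_zero_iff, norm_smul, Real.norm_of_nonneg (zero_le_one.trans ht)] at this
    nlinarith [mem_Ici.1 ht]
  have hxray : x ∈ (fun t : ℝ => t • x) '' Ici 1 := ⟨1, self_mem_Ici, one_smul ℝ x⟩
  rcases hx with hx | hx
  · exact hray hxray hx
  · have hpre : IsPreconnected ((fun t : ℝ => t • x) '' Ici 1) :=
      isPreconnected_Ici.image _ (by fun_prop)
    have hbdd := hx.2.subset (hpre.subset_connectedComponentIn hxray hray)
    obtain ⟨M, hM⟩ := isBounded_iff_forall_norm_le.1 hbdd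
    have h := hM _ ⟨max 1 ((M + 1) / ‖x‖), mem_Ici.2 (le_max_left _ _), rfl⟩
    rw [norm_smul, Real.norm_of_nonneg (by positivity)] at h
    have hx0 : 0 < ‖x‖ := hr.trans hxr
    have := mul_le_mul_of_nonneg_right (le_max_right 1 ((M + 1) / ‖x‖)) hx0.le
    rw [div_mul_cancel₀ _ hx0.ne'] at this
    linarith

theorem isCompact_region : IsCompact P.region :=
  Metric.isCompact_of_isClosed_isBounded P.isClosed_region P.isBounded_region

/-! ### Chains are nonempty -/

theorem traversal_add [NeZero n] {s : ℝ} (hs : 0 ≤ s) :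
    P.traversal (s + n) = P.traversal s := by
  have h : Fin.ofNat n (⌊s⌋₊ + n) = Fin.ofNat n ⌊s⌋₊ := by
    ext
    simp
  rw [traversal, traversal, Nat.floor_add_natCast hs, h, Int.fract_add_natCast]

theorem exists_traversal_eq [NeZero n] {a : EuclideanSpace ℝ (Fin 2)} (ha : a ∈ P.boundary ℝ) :
    ∃ s : ℝ, 0 ≤ s ∧ s < n ∧ P.traversal s = a := by
  have key : ∀ (i : Fin n) (r : ℝ), 0 ≤ r → r < 1 →
      ∃ s : ℝ, 0 ≤ s ∧ s < n ∧ P.traversal s = P.edgePath ℝ i r := by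
    intro i r h0 h1
    refine ⟨(i : ℕ) + r, by positivity, ?_, ?_⟩
    · have : ((i : ℕ) : ℝ) + 1 ≤ n := by exact_mod_cast i.2
      linarith
    · have hf : ⌊((i : ℕ) : ℝ) + r⌋₊ = i := by
        rw [Nat.floor_eq_iff (by positivity)]
        constructor <;> linarith
      have hr : Int.fract (((i : ℕ) : ℝ) + r) = r := by
        rw [Int.fract_natCast_add, Int.fract_eq_self.2 ⟨h0, h1⟩]
      rw [traversal, hf, hr]
      simp
  obtain ⟨i, hi⟩ := mem_iUnion.1 ha
  rw [edgeSet_eq_image_edgePath] at hi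
  obtain ⟨r, ⟨h0, h1⟩, rfl⟩ := hi
  rcases h1.lt_or_eq with h1 | rfl
  · exact key i r h0 h1
  · -- the end of an edge is the beginning of the next one
    obtain ⟨s, hs0, hsn, hs⟩ := key (finRotate n i) 0 le_rfl one_pos
    exact ⟨s, hs0, hsn, by simp [hs, edgePath]⟩

theorem chain_nonempty [NeZero n] {a b : EuclideanSpace ℝ (Fin 2)} (ha : a ∈ P.boundary ℝ)
    (hb : b ∈ P.boundary ℝ) : (P.chain a b).Nonempty := by
  obtain ⟨s, hs0, hsn, hs⟩ := P.exists_traversal_eq ha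
  obtain ⟨t, ht0, htn, ht⟩ := P.exists_traversal_eq hb
  rcases le_or_gt s t with hst | hst
  · exact ⟨a, s, s, t, hs0, le_rfl, hst, by linarith, hs, hs, ht⟩
  · exact ⟨a, s, s, t + n, hs0, le_rfl, by linarith, by linarith, hs, hs,
      by rw [P.traversal_add ht0, ht]⟩

end Polygon

open Polygon in
theorem mainTheorem7 {n : ℕ} [NeZero n] (P : Polygon (EuclideanSpace ℝ (Fin 2)) n)
    (hP : P.IsSimple) (a b : EuclideanSpace ℝ (Fin 2))
    (ha : a ∈ P.boundary ℝ) (hb : b ∈ P.boundary ℝ) :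
    IsPreconnected (P.feasibleRegion a b) ∧
      ∀ C : Set (EuclideanSpace ℝ (Fin 2)), C ⊆ P.region → Convex ℝ C →
        Convex ℝ (C ∩ P.feasibleRegion a b) :=
  -- the feasible region is by definition `commonlyVisible P.region (P.chain a b)`
  ⟨P.holeFree_region.isPreconnected_commonlyVisible P.isCompact_region (P.chain_nonempty ha hb),
    fun _ hCR hC => P.holeFree_region.convex_inter_commonlyVisible hCR hC⟩
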